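/- Let $X$ be a finite alphabet with $n\ge 2$ letters and let $X^*$ be the free monoid of words over $X$, with $|w|$ denoting the length of a word $w$. Put $A(n)=\lfloor 9n^3\sqrt{n\log n}\rfloor$, where $\log$ is the natural logarithm. For a morphism $f:X^*\to X^*$ and a word $w\in X^*$, the infinite word $f^\omega(w)$ exists if and only if $w$ is a prefix of $f(w)$ and $|f^i(w)|\to\infty$ as $i\to\infty$; in that case $f^\omega(w)$ is the unique infinite word having every $f^i(w)$, $i\ge 0$, as a prefix. The morphism $f$ is primitive if there is an integer $k\ge 1$ such that for all $y,z\in X$ the letter $z$ occurs in $f^k(y)$. It is looping if there are an integer $k\ge 1$, a letter $y\in X$ and a nonempty word $u\in X^*$ such that $(f^k)^\omega(y)$ exists and $(f^k)^\omega(y)=u^\omega=uuu\cdots$, and it is loop-free otherwise. Let $M_f=\max\{|f(y)| : y\in X\}$. For morphisms $g,h:X^*\to X^*$ let $$\mathrm{BAL}(g,h)=\sup\{\,\bigl||g(g^k(y))|-|h(g^k(y))|\bigr| : y\in X,\ k\ge 0\,\}\in\mathbb{N}\cup\{\infty\},$$ $$\mathrm{COMP}(g,h)=\{\,w\in X^*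 : g(w)u_1=h(w)u_2 \text{ for some } u_1,u_2\in X^*\,\}.$$ Let $g,h:X^*\to X^*$ be primitive morphisms and let $x\in X$ be a letter such that $g^\omega(x)$ and $h^\omega(x)$ exist. Assume that $g$ is loop-free, $\mathrm{BAL}(g,h)<\infty$ and $M_h\le M_g^2$. Then $$g^\omega(x)=h^\omega(x)\quad\text{if and only if}\quad g^{A(n)}(x)\in\mathrm{COMP}(g,h).$$ -/

import Mathlib

/-!  Words over an alphabet `X` are elements of `FreeMonoid X`, morphisms `X* → X*` are elements of
`Monoid.End (FreeMonoid X)` (so `g ^ k` is the `k`-th iterate of `g`), and infinite words over `X`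
are functions `ℕ → X`. -/

namespace MorphicWord

variable {X : Type*}

/-- The word `u` is a prefix of the word `v`. -/
def IsPrefix (u v : FreeMonoid X) : Prop :=
  ∃ t : FreeMonoid X, v = u * t

/-- The word `u` is a prefix of the infinite word `s`. -/
def IsPrefixInf (u : FreeMonoid X) (s : ℕ → X) : Prop :=
  ∀ (i : ℕ) (hi : i < u.toList.length), s i = u.toList[i]

/-- `g` is primitive: for some `k ≥ 1` every letter `y` occurs in `g ^ k (x)` for every
letter `x`. -/
def IsPrimitive (g : Monoid.End (FreeMonoid X)) : Prop :=
  ∃ k : ℕ, 0 < k ∧ ∀ x y : X, y ∈ (g ^ k) (FreeMonoid.of x)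

/-- `g^ω(w)` exists: `w` is a prefix of `g(w)` and `|g^n(w)| → ∞`. -/
def OmegaExists (g : Monoid.End (FreeMonoid X)) (w : FreeMonoid X) : Prop :=
  IsPrefix w (g w) ∧
    Filter.Tendsto (fun n : ℕ => ((g ^ n) w).length) Filter.atTop Filter.atTop

theorem IsPrefix.trans {u v w : FreeMonoid X} (h₁ : IsPrefix u v) (h₂ : IsPrefix v w) :
    IsPrefix u w := by
  obtain ⟨s, rfl⟩ := h₁
  obtain ⟨t, rfl⟩ := h₂
  exact ⟨s * t, mul_assoc u s t⟩

theorem isPrefix_pow_succ {g : Monoid.End (FreeMonoid X)} {w : FreeMonoid X}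
    (h : IsPrefix w (g w)) (n : ℕ) : IsPrefix ((g ^ n) w) ((g ^ (n + 1)) w) := by
  obtain ⟨t, ht⟩ := h
  refine ⟨(g ^ n) t, ?_⟩
  rw [pow_succ, Monoid.End.coe_mul, Function.comp_apply, ht, map_mul]

theorem isPrefix_pow {g : Monoid.End (FreeMonoid X)} {w : FreeMonoid X}
    (h : IsPrefix w (g w)) {m n : ℕ} (hmn : m ≤ n) : IsPrefix ((g ^ m) w) ((g ^ n) w) := by
  induction n, hmn using Nat.le_induction with
  | base => exact ⟨1, (mul_one _).symm⟩
  | succ n _ ih => exact ih.trans (isPrefix_pow_succ h n)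

theorem IsPrefix.getElem_eq {u v : FreeMonoid X} (h : IsPrefix u v) {i : ℕ}
    (hu : i < u.toList.length) (hv : i < v.toList.length) : u.toList[i] = v.toList[i] := by
  obtain ⟨t, rfl⟩ := h
  exact (List.getElem_append_left hu).symm

/-- If `g^ω(w)` exists, there is exactly one infinite word having all `g^n(w)` as prefixes. -/
theorem OmegaExists.existsUnique {g : Monoid.End (FreeMonoid X)} {w : FreeMonoid X}
    (h : OmegaExists g w) : ∃! s : ℕ → X, ∀ n : ℕ, IsPrefixInf ((g ^ n) w) s := by
  have hex : ∀ i : ℕ, ∃ n : ℕ, i < ((g ^ n) w).toList.length := fun i =>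
    (h.2.eventually_gt_atTop i).exists
  choose N hN using hex
  refine ⟨fun i => ((g ^ N i) w).toList[i]'(hN i), ?_, ?_⟩
  · intro n i hi
    rcases le_total (N i) n with hle | hle
    · exact (isPrefix_pow h.1 hle).getElem_eq (hN i) hi
    · exact ((isPrefix_pow h.1 hle).getElem_eq hi (hN i)).symm
  · intro s hs
    funext i
    exact hs (N i) i (hN i)

/-- The infinite word `g^ω(w)`: the unique infinite word having all `g^n(w)` as prefixes. -/
noncomputable def omega (g : Monoid.End (FreeMonoid X)) (w : FreeMonoid X)
    (h : OmegaExists g w) : ℕ → X :=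
  h.existsUnique.choose

theorem isPrefixInf_omega {g : Monoid.End (FreeMonoid X)} {w : FreeMonoid X}
    (h : OmegaExists g w) (n : ℕ) : IsPrefixInf ((g ^ n) w) (omega g w h) :=
  h.existsUnique.choose_spec.1 n

/-- The periodic infinite word `u^ω = uuu⋯` for a nonempty word `u`. -/
def omegaPower (u : FreeMonoid X) (hu : u ≠ 1) : ℕ → X := fun i =>
  u.toList[i % u.toList.length]'(Nat.mod_lt i (List.length_pos_iff.mpr hu))

/-- `g` is looping: for some `k ≥ 1`, letter `x` and nonempty word `u`, the infinite word
`(g^k)^ω(x)` exists and equals `u^ω`. -/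
def IsLooping (g : Monoid.End (FreeMonoid X)) : Prop :=
  ∃ (k : ℕ) (x : X) (u : FreeMonoid X) (hu : u ≠ 1)
    (h : OmegaExists (g ^ k) (FreeMonoid.of x)),
    0 < k ∧ omega (g ^ k) (FreeMonoid.of x) h = omegaPower u hu

/-- `g` is loop-free if it is not looping. -/
def IsLoopFree (g : Monoid.End (FreeMonoid X)) : Prop :=
  ¬ IsLooping g

/-- `M_g`, the maximal length of `g(x)` for letters `x`. -/
def maxLength [Fintype X] (g : Monoid.End (FreeMonoid X)) : ℕ :=
  Finset.univ.sup fun x : X => (g (FreeMonoid.of x)).length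

/-- `BAL(g, h)`, the supremum in `ℕ ∪ {∞}` of `||g g^k(x)| - |h g^k(x)||` over all letters `x`
and all `k ≥ 0`. -/
noncomputable def balance (g h : Monoid.End (FreeMonoid X)) : ℕ∞ :=
  ⨆ (x : X) (k : ℕ),
    ((((g ((g ^ k) (FreeMonoid.of x))).length : ℤ) -
      ((h ((g ^ k) (FreeMonoid.of x))).length : ℤ)).natAbs : ℕ∞)

/-- `COMP(g, h)`, the set of words `w` such that `g(w) u₁ = h(w) u₂` for some words
`u₁`, `u₂`. -/
def comp (g h : Monoid.End (FreeMonoid X)) : Set (FreeMonoid X) :=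
  {w | ∃ u₁ u₂ : FreeMonoid X, g w * u₁ = h w * u₂}

/-- `A(n) = ⌊9 n³ √(n log n)⌋`, with the natural logarithm. -/
noncomputable def boundA (n : ℕ) : ℕ :=
  ⌊9 * (n : ℝ) ^ 3 * Real.sqrt ((n : ℝ) * Real.log (n : ℝ))⌋₊

end MorphicWord

namespace MorphicWord

/-! ### Explicit polynomial bounds for bounded orbits of a linear map. -/

section BoundedOrbits

open Polynomial

/-! Write `s` for `g^ω(x)`, `M` for `M_g`, and call `|g(g^k(w))| - |h(g^k(w))|` the shift after `w`.
If the fixed points agree, `g(g^A(x))` and `h(g^A(x))` are both prefixes of `s`. The converse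
spreads compatibility from one long prefix of `s` to all of `s`.

The finite balance has no a priori size. However, the shifts of letters form an orbit of the
transposed incidence matrix of `g`; on the invariant subspace of bounded orbits all eigenvalues have
modulus at most 1, so Cayley–Hamilton gives a bound polynomial in `k`: `M^(2n) k^n`
(`abs_diff_pow_le`). Lengths of iterates grow exponentially by primitivity, so for suitable `k` the
images of letters under `g^(k+1)` are much longer than the shifts.

In the compatible range the shift before an occurrence of a letter `y` depends only on `y`
(`diff_takePrefix_eq`). Two different shifts would align `g^(k+1)(y)` with `h(g^k(y))` in two ways
and give its interior a small period; that interior contains `g^(ne)` of every pair of adjacent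
letters of `s`, so `s` would be periodic and `g` looping.

Every pair occurs early in `s`. Hence each new pair has an early copy with the same shift, and the
overhang, covered by the image of the pair's first letter, continues in the same way
(`compatible_pow_takePrefix`). Compatibility along all of `s` then forces `h^j(x)` to be a prefix of
`s` for every `j`. The argument needs only `10 n^3 ≤ A(n)`. -/

theorem norm_pow_apply_le_of_prod_eq_zero {E : Type*} [NormedAddCommGroup E] [NormedSpace ℂ E]
    (T : Module.End ℂ E) (M : ℝ) (hM : 0 ≤ M) (hT : ∀ v, ‖T v‖ ≤ M * ‖v‖) (l : List ℂ)
    (hl : ∀ μ ∈ l, ‖μ‖ ≤ 1) (v : E)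
    (hv : (l.map fun μ => T - algebraMap ℂ (Module.End ℂ E) μ).prod v = 0) (k : ℕ) :
    ‖(T ^ k) v‖ ≤ (∑ j ∈ Finset.range l.length, (k.choose j : ℝ) * (M + 1) ^ j) * ‖v‖ := by
  -- Each factor is peeled off: `w = (T - μ) v` is killed by the remaining product, and `T^(k+1) v =
  -- μ T^k v + T^k w` turns the bound for `w` into Pascal's rule.
  induction l generalizing v k with
  | nil =>
    have : v = 0 := by simpa using hv
    simp [this]
  | cons μ l ih =>
    have hcomm : ∀ l : List ℂ, Commute (T - algebraMap ℂ (Module.End ℂ E) μ)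
        (l.map fun μ => T - algebraMap ℂ (Module.End ℂ E) μ).prod := by
      intro l
      refine Commute.list_prod_right _ _ fun b hb => ?_
      obtain ⟨ν, -, rfl⟩ := List.mem_map.1 hb
      refine Commute.sub_left (Commute.sub_right (Commute.refl _) ?_) (Commute.sub_right ?_ ?_)
      · exact Algebra.commute_algebraMap_right _ _
      · exact Algebra.commute_algebraMap_left _ _
      · exact Algebra.commute_algebraMap_left _ _
    set w := (T - algebraMap ℂ (Module.End ℂ E) μ) v with hw
    have hTv : T v = μ • v + w := by
      simp [hw, Module.algebraMap_end_apply]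
    have hnw : ‖w‖ ≤ (M + 1) * ‖v‖ := by
      have h1 : w = T v - μ • v := by simp [hw, Module.algebraMap_end_apply]
      have h2 : ‖μ • v‖ ≤ ‖v‖ := by
        rw [norm_smul]
        exact mul_le_of_le_one_left (norm_nonneg _) (hl μ (by simp))
      calc ‖w‖ ≤ ‖T v‖ + ‖μ • v‖ := h1 ▸ norm_sub_le _ _
        _ ≤ M * ‖v‖ + ‖v‖ := add_le_add (hT v) h2
        _ = (M + 1) * ‖v‖ := by ring
    have hw0 : (l.map fun μ => T - algebraMap ℂ (Module.End ℂ E) μ).prod w = 0 := by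
      rw [List.map_cons, List.prod_cons, (hcomm l).eq] at hv
      exact hv
    have ihw := ih (fun ν hν => hl ν (by simp [hν])) w hw0
    induction k with
    | zero =>
      have : (1 : ℝ) ≤ ∑ j ∈ Finset.range (μ :: l).length,
          ((0 : ℕ).choose j : ℝ) * (M + 1) ^ j := by
        rw [List.length_cons, Finset.sum_range_succ']
        simp
      simpa using mul_le_mul_of_nonneg_right this (norm_nonneg v)
    | succ k ihk =>
      have h1 : (T ^ (k + 1)) v = μ • (T ^ k) v + (T ^ k) w := by
        rw [pow_succ, Module.End.mul_apply, hTv, map_add, map_smul]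
      have h2 : ‖μ • (T ^ k) v‖ ≤ ‖(T ^ k) v‖ := by
        rw [norm_smul]
        exact mul_le_of_le_one_left (norm_nonneg _) (hl μ (by simp))
      have h3 : ‖(T ^ k) w‖ ≤ (∑ j ∈ Finset.range l.length,
          (k.choose j : ℝ) * (M + 1) ^ (j + 1)) * ‖v‖ := by
        refine (ihw k).trans ?_
        calc _ ≤ (∑ j ∈ Finset.range l.length, (k.choose j : ℝ) * (M + 1) ^ j) *
              ((M + 1) * ‖v‖) := by gcongr
          _ = _ := by
            rw [← mul_assoc, Finset.sum_mul]
            congr 1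
            refine Finset.sum_congr rfl fun j _ => ?_
            ring
      have h4 : ∑ j ∈ Finset.range (μ :: l).length, ((k + 1).choose j : ℝ) * (M + 1) ^ j =
          ∑ j ∈ Finset.range (μ :: l).length, (k.choose j : ℝ) * (M + 1) ^ j +
          ∑ j ∈ Finset.range l.length, (k.choose j : ℝ) * (M + 1) ^ (j + 1) := by
        rw [List.length_cons, Finset.sum_range_succ', Finset.sum_range_succ']
        simp only [Nat.choose_succ_succ, Nat.cast_add, add_mul, Finset.sum_add_distrib]
        simp
        ring
      rw [h1, h4, add_mul]
      exact (norm_add_le _ _).trans (add_le_add (h2.trans ihk) h3)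

/-- The vectors with bounded orbit under `T`. -/
def boundedOrbits {E : Type*} [NormedAddCommGroup E] [NormedSpace ℂ E] (T : Module.End ℂ E) :
    Submodule ℂ E where
  carrier := {v | ∃ C : ℝ, ∀ k : ℕ, ‖(T ^ k) v‖ ≤ C}
  zero_mem' := ⟨0, fun k => by simp⟩
  add_mem' := by
    rintro a b ⟨C, hC⟩ ⟨D, hD⟩
    exact ⟨C + D, fun k => by
      rw [map_add]; exact (norm_add_le _ _).trans (add_le_add (hC k) (hD k))⟩
  smul_mem' := by
    rintro c a ⟨C, hC⟩
    exact ⟨‖c‖ * C, fun k => by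
      rw [map_smul, norm_smul]; exact mul_le_mul_of_nonneg_left (hC k) (norm_nonneg _)⟩

theorem apply_mem_boundedOrbits {E : Type*} [NormedAddCommGroup E] [NormedSpace ℂ E]
    (T : Module.End ℂ E) (v : E) (hv : v ∈ boundedOrbits T) : T v ∈ boundedOrbits T := by
  obtain ⟨C, hC⟩ := hv
  refine ⟨C, fun k => ?_⟩
  have := hC (k + 1)
  rwa [pow_succ, Module.End.mul_apply] at this

theorem norm_le_one_of_hasEigenvector {E : Type*} [NormedAddCommGroup E] [NormedSpace ℂ E]
    (T : Module.End ℂ E) (v : E) (hv : v ∈ boundedOrbits T) (hv0 : v ≠ 0) (μ : ℂ)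
    (h : T v = μ • v) : ‖μ‖ ≤ 1 := by
  obtain ⟨C, hC⟩ := hv
  have hpow : ∀ k : ℕ, (T ^ k) v = μ ^ k • v := by
    intro k
    induction k with
    | zero => simp
    | succ k ih => rw [pow_succ, Module.End.mul_apply, h, map_smul, ih, smul_smul, pow_succ']
  by_contra! hμ
  have hpos : 0 < ‖v‖ := norm_pos_iff.2 hv0
  obtain ⟨k, hk⟩ := pow_unbounded_of_one_lt (C / ‖v‖) hμ
  have := hC k
  rw [hpow, norm_smul, norm_pow] at this
  rw [div_lt_iff₀ hpos] at hk
  linarith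

/-- A bounded orbit of a linear map has at most polynomial size, with explicit constants. -/
theorem norm_pow_apply_le_of_bounded {E : Type*} [NormedAddCommGroup E] [NormedSpace ℂ E]
    [FiniteDimensional ℂ E] (T : Module.End ℂ E) (M : ℝ) (hM : 0 ≤ M)
    (hT : ∀ v, ‖T v‖ ≤ M * ‖v‖) (v : E) (hv : ∃ C : ℝ, ∀ k : ℕ, ‖(T ^ k) v‖ ≤ C) (k : ℕ) :
    ‖(T ^ k) v‖ ≤
      (∑ j ∈ Finset.range (Module.finrank ℂ E), (k.choose j : ℝ) * (M + 1) ^ j) * ‖v‖ := by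
  set U := boundedOrbits T
  set f : Module.End ℂ U := T.restrict (apply_mem_boundedOrbits T) with hf
  set l : List ℂ := f.charpoly.roots.toList with hl
  -- Cayley–Hamilton on the subspace of bounded orbits, with the characteristic polynomial split
  -- over `ℂ`.
  have hprod : (l.map fun μ => f - algebraMap ℂ (Module.End ℂ U) μ).prod = 0 := by
    have h1 := (IsAlgClosed.splits f.charpoly).eq_prod_roots_of_monic (LinearMap.charpoly_monic f)
    have h2 := LinearMap.aeval_self_charpoly f
    have h3 : f.charpoly = (l.map fun a => X - C a).prod := by
      conv_lhs => rw [h1]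
      rw [← Multiset.prod_coe, ← Multiset.map_coe, hl, Multiset.coe_toList]
    rw [h3, map_list_prod, List.map_map] at h2
    rw [← h2]
    congr 1
    refine List.map_congr_left fun a _ => ?_
    simp
  have hlen : l.length ≤ Module.finrank ℂ E := by
    rw [hl, Multiset.length_toList, ← (IsAlgClosed.splits f.charpoly).natDegree_eq_card_roots,
      LinearMap.charpoly_natDegree]
    exact Submodule.finrank_le U
  have hnorm : ∀ μ ∈ l, ‖μ‖ ≤ 1 := by
    intro μ hμ
    rw [hl, Multiset.mem_toList] at hμ
    have := (Module.End.hasEigenvalue_iff_isRoot_charpoly f μ).2 (Polynomial.isRoot_of_mem_roots hμ)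
    obtain ⟨u, hu⟩ := this.exists_hasEigenvector
    refine norm_le_one_of_hasEigenvector T u u.2 (fun h => hu.2 (Subtype.ext h)) μ ?_
    exact congrArg Subtype.val hu.apply_eq_smul
  have hpow : ∀ (j : ℕ) (u : U), (((f ^ j) u : U) : E) = (T ^ j) u := by
    intro j
    induction j with
    | zero => intro u; simp
    | succ j ih => intro u; rw [pow_succ, pow_succ, Module.End.mul_apply, ih]; rfl
  have key := norm_pow_apply_le_of_prod_eq_zero f M hM (fun u => hT u) l hnorm ⟨v, hv⟩
    (by rw [hprod]; rfl) k
  rw [Submodule.coe_norm, hpow] at key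
  refine key.trans ?_
  refine mul_le_mul_of_nonneg_right ?_ (norm_nonneg v)
  refine Finset.sum_le_sum_of_subset_of_nonneg ?_ fun _ _ _ => by positivity
  exact Finset.range_subset_range.2 hlen

end BoundedOrbits

variable {X : Type*}

/-! ### Prefixes, factors and lengths of words. -/

section Words

theorem length_eq_toList_length (u : FreeMonoid X) : u.length = u.toList.length := rfl

theorem pow_add_apply (g : Monoid.End (FreeMonoid X)) (i j : ℕ) (w : FreeMonoid X) :
    (g ^ (i + j)) w = (g ^ i) ((g ^ j) w) := by
  rw [pow_add]; rfl

theorem pow_succ_apply (g : Monoid.End (FreeMonoid X)) (i : ℕ) (w : FreeMonoid X) :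
    (g ^ (i + 1)) w = (g ^ i) (g w) := by
  rw [pow_succ]; rfl

theorem pow_succ_apply' (g : Monoid.End (FreeMonoid X)) (i : ℕ) (w : FreeMonoid X) :
    (g ^ (i + 1)) w = g ((g ^ i) w) := by
  rw [pow_succ']; rfl

theorem IsPrefix.length_le {u v : FreeMonoid X} (h : IsPrefix u v) : u.length ≤ v.length := by
  obtain ⟨t, rfl⟩ := h
  rw [FreeMonoid.length_mul]; omega

theorem IsPrefix.map (f : Monoid.End (FreeMonoid X)) {u v : FreeMonoid X} (h : IsPrefix u v) :
    IsPrefix (f u) (f v) := by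
  obtain ⟨t, rfl⟩ := h
  exact ⟨f t, map_mul f u t⟩

theorem isPrefix_mul_right (u v : FreeMonoid X) : IsPrefix u (u * v) := ⟨v, rfl⟩

theorem isPrefix_of_length_le {u v w : FreeMonoid X} (hu : IsPrefix u w) (hv : IsPrefix v w)
    (h : u.length ≤ v.length) : IsPrefix u v := by
  obtain ⟨s, hs⟩ := hu
  obtain ⟨t, ht⟩ := hv
  have h1 : u.toList <+: w.toList := ⟨s.toList, by rw [hs]; rfl⟩
  have h2 : v.toList <+: w.toList := ⟨t.toList, by rw [ht]; rfl⟩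
  obtain ⟨r, hr⟩ := List.prefix_of_prefix_length_le h1 h2 h
  exact ⟨FreeMonoid.ofList r, hr.symm⟩

/-- `u` is a factor of `v`. -/
def IsFactor (u v : FreeMonoid X) : Prop := ∃ a b, v = a * u * b

theorem IsFactor.trans {u v w : FreeMonoid X} (h₁ : IsFactor u v) (h₂ : IsFactor v w) :
    IsFactor u w := by
  obtain ⟨a, b, rfl⟩ := h₁
  obtain ⟨c, d, rfl⟩ := h₂
  exact ⟨c * a, b * d, by simp only [mul_assoc]⟩

theorem IsFactor.map (f : Monoid.End (FreeMonoid X)) {u v : FreeMonoid X} (h : IsFactor u v) :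
    IsFactor (f u) (f v) := by
  obtain ⟨a, b, rfl⟩ := h
  exact ⟨f a, f b, by simp only [map_mul]⟩

theorem IsFactor.length_le {u v : FreeMonoid X} (h : IsFactor u v) : u.length ≤ v.length := by
  obtain ⟨a, b, rfl⟩ := h
  simp only [FreeMonoid.length_mul]; omega

theorem IsPrefix.isFactor {u v : FreeMonoid X} (h : IsPrefix u v) : IsFactor u v := by
  obtain ⟨t, rfl⟩ := h
  exact ⟨1, t, by rw [one_mul]⟩

theorem isFactor_of_iff_mem {y : X} {w : FreeMonoid X} : IsFactor (FreeMonoid.of y) w ↔ y ∈ w := by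
  constructor
  · rintro ⟨a, b, rfl⟩
    simp [FreeMonoid.mem_mul, FreeMonoid.mem_of]
  · intro h
    obtain ⟨a, b, hab⟩ := List.append_of_mem (show y ∈ w.toList from h)
    refine ⟨FreeMonoid.ofList a, FreeMonoid.ofList b, ?_⟩
    apply FreeMonoid.toList.injective
    rw [hab]
    simp

theorem mem_map_iff (f : Monoid.End (FreeMonoid X)) (z : X) (w : FreeMonoid X) :
    z ∈ f w ↔ ∃ t ∈ w, z ∈ f (FreeMonoid.of t) := by
  induction w using FreeMonoid.inductionOn' with
  | one => simp [FreeMonoid.notMem_one]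
  | of_mul b a ih =>
    rw [map_mul, FreeMonoid.mem_mul, ih]
    simp [FreeMonoid.mem_mul, FreeMonoid.mem_of]

theorem mul_length_le_length_map (f : Monoid.End (FreeMonoid X)) (c : ℕ)
    (hf : ∀ y, c ≤ (f (FreeMonoid.of y)).length) (w : FreeMonoid X) :
    c * w.length ≤ (f w).length := by
  induction w using FreeMonoid.inductionOn' with
  | one => simp
  | of_mul b a ih =>
    rw [map_mul, FreeMonoid.length_mul, FreeMonoid.length_mul, FreeMonoid.length_of]
    have := hf b
    nlinarith

theorem length_map_le (f : Monoid.End (FreeMonoid X)) (c : ℕ)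
    (hf : ∀ y, (f (FreeMonoid.of y)).length ≤ c) (w : FreeMonoid X) :
    (f w).length ≤ c * w.length := by
  induction w using FreeMonoid.inductionOn' with
  | one => simp
  | of_mul b a ih =>
    rw [map_mul, FreeMonoid.length_mul, FreeMonoid.length_mul, FreeMonoid.length_of]
    have := hf b
    nlinarith

theorem length_pos_iff_ne_one {w : FreeMonoid X} : 0 < w.length ↔ w ≠ 1 := by
  rw [Nat.pos_iff_ne_zero, Ne, FreeMonoid.length_eq_zero]

end Words

/-! ### Compatible words, overhangs and shifts. -/

section Compatible

/-- `u` and `v` have a common right extension, i.e. one of them is a prefix of the other. -/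
def Compatible (u v : FreeMonoid X) : Prop := ∃ a b, u * a = v * b

theorem Compatible.symm {u v : FreeMonoid X} (h : Compatible u v) : Compatible v u := by
  obtain ⟨a, b, h⟩ := h
  exact ⟨b, a, h.symm⟩

theorem Compatible.of_isPrefix {u v u' v' : FreeMonoid X} (h : Compatible u v)
    (hu : IsPrefix u' u) (hv : IsPrefix v' v) : Compatible u' v' := by
  obtain ⟨a, b, h⟩ := h
  obtain ⟨s, rfl⟩ := hu
  obtain ⟨t, rfl⟩ := hv
  exact ⟨s * a, t * b, by simpa only [mul_assoc] using h⟩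

theorem Compatible.isPrefix {u v : FreeMonoid X} (h : Compatible u v)
    (hl : u.length ≤ v.length) : IsPrefix u v := by
  obtain ⟨a, b, h⟩ := h
  exact isPrefix_of_length_le (isPrefix_mul_right u a) (h ▸ isPrefix_mul_right v b) hl

theorem compatible_of_isPrefix {u v w : FreeMonoid X} (hu : IsPrefix u w) (hv : IsPrefix v w) :
    Compatible u v := by
  obtain ⟨s, rfl⟩ := hu
  obtain ⟨t, ht⟩ := hv
  exact ⟨s, t, ht⟩

theorem Compatible.mul_left {u v : FreeMonoid X} (h : Compatible u v) (w : FreeMonoid X) :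
    Compatible (w * u) (w * v) := by
  obtain ⟨a, b, h⟩ := h
  exact ⟨a, b, by rw [mul_assoc, h, mul_assoc]⟩

theorem Compatible.of_mul_left {u v w : FreeMonoid X} (h : Compatible (w * u) (w * v)) :
    Compatible u v := by
  obtain ⟨a, b, h⟩ := h
  exact ⟨a, b, by rw [mul_assoc, mul_assoc] at h; exact mul_left_cancel h⟩

theorem suffix_of_mul_eq_mul {a u b c : FreeMonoid X} (h : a * u = b * c)
    (hl : c.length ≤ u.length) : ∃ d, u = d * c := by
  have h1 : u.toList <:+ (a * u).toList := ⟨a.toList, rfl⟩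
  have h2 : c.toList <:+ (a * u).toList := ⟨b.toList, by rw [h]; rfl⟩
  obtain ⟨d, hd⟩ := List.suffix_of_suffix_length_le h2 h1 hl
  exact ⟨FreeMonoid.ofList d, hd.symm⟩

theorem eq_of_mul_eq_mul {a b c d : FreeMonoid X} (h : a * b = c * d)
    (hl : b.length = d.length) : b = d := by
  exact (List.append_inj' (s₁ := a.toList) (s₂ := c.toList) h hl).2

/-- Both overhangs are suffixes of `u` of the same length, hence equal; whether the continuations
fit depends only on the overhang, `u'` and `v'`. -/
theorem Compatible.extend_of_le {a b u v u' v' a₀ b₀ : FreeMonoid X}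
    (h : Compatible (a * u) (b * v)) (h₀ : Compatible (a₀ * u * u') (b₀ * v * v'))
    (hle : (b * v).length ≤ (a * u).length)
    (hd : (a * u).length + (b₀ * v).length = (a₀ * u).length + (b * v).length)
    (hu : (a * u).length ≤ (b * v).length + u.length) :
    Compatible (a * u * u') (b * v * v') := by
  obtain ⟨c, hc⟩ := h.symm.isPrefix hle
  obtain ⟨c₀, hc₀⟩ := (h₀.symm.of_isPrefix (isPrefix_mul_right _ _)
    (isPrefix_mul_right _ _)).isPrefix (show (b₀ * v).length ≤ (a₀ * u).length by omega)
  have e1 := congrArg FreeMonoid.length hc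
  have e2 := congrArg FreeMonoid.length hc₀
  rw [FreeMonoid.length_mul _ c] at e1
  rw [FreeMonoid.length_mul _ c₀] at e2
  obtain ⟨d, hd1⟩ := suffix_of_mul_eq_mul hc (by omega)
  obtain ⟨d₀, hd0⟩ := suffix_of_mul_eq_mul hc₀ (by omega)
  have hcc : c = c₀ := eq_of_mul_eq_mul (hd1.symm.trans hd0) (by omega)
  rw [hc₀, mul_assoc] at h₀
  rw [hc, mul_assoc, hcc]
  exact h₀.of_mul_left.mul_left _

/-- If the overhang after `a * u`, `b * v` has the same length as after `a₀ * u`, `b₀ * v`, and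
is covered by `u` and `v`, then compatible continuations are the same in both places. -/
theorem Compatible.extend {a b u v u' v' a₀ b₀ : FreeMonoid X}
    (h : Compatible (a * u) (b * v)) (h₀ : Compatible (a₀ * u * u') (b₀ * v * v'))
    (hd : (a * u).length + (b₀ * v).length = (a₀ * u).length + (b * v).length)
    (hu : (a * u).length ≤ (b * v).length + u.length)
    (hv : (b * v).length ≤ (a * u).length + v.length) :
    Compatible (a * u * u') (b * v * v') := by
  rcases le_total (b * v).length (a * u).length with hle | hle
  · exact h.extend_of_le h₀ hle hd hu
  · exact (h.symm.extend_of_le h₀.symm hle (by omega) hv).symm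

theorem getElem?_mul_right (a u : FreeMonoid X) (i : ℕ) :
    (a * u).toList[a.length + i]? = u.toList[i]? := by
  rw [FreeMonoid.toList_mul, length_eq_toList_length,
    List.getElem?_append_right (Nat.le_add_right _ _), Nat.add_sub_cancel_left]

theorem getElem?_mul_left (a u : FreeMonoid X) {i : ℕ} (hi : i < a.length) :
    (a * u).toList[i]? = a.toList[i]? := by
  rw [FreeMonoid.toList_mul]
  exact List.getElem?_append_left hi

theorem Compatible.getElem?_eq {a b u v : FreeMonoid X} (h : Compatible (a * u) (b * v)) {i j : ℕ}
    (hij : a.length + i = b.length + j) (hi : i < u.length) (hj : j < v.length) :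
    u.toList[i]? = v.toList[j]? := by
  obtain ⟨s, t, h⟩ := h
  rw [mul_assoc, mul_assoc] at h
  have h1 := getElem?_mul_right a (u * s) i
  have h2 := getElem?_mul_right b (v * t) j
  rw [h, hij, h2, getElem?_mul_left _ _ hi, getElem?_mul_left _ _ hj] at h1
  exact h1.symm

/-- Two different shifts aligning `u` with `v` make the inner part of `u` periodic. -/
theorem Compatible.periodic {a b a' b' u v : FreeMonoid X} {d d' : ℤ} {B : ℕ}
    (h : Compatible (a * u) (b * v)) (h' : Compatible (a' * u) (b' * v))
    (hd : (a.length : ℤ) - b.length = d) (hd' : (a'.length : ℤ) - b'.length = d')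
    (hB : |d| ≤ B) (hB' : |d'| ≤ B) (hlt : d < d') (huv : u.length ≤ v.length + B) (i : ℕ)
    (hi : B ≤ i) (hi' : i + 2 * B < u.length) :
    u.toList[i]? = u.toList[i + (d' - d).toNat]? := by
  rw [abs_le] at hB hB'
  -- Position `i` under shift `d'` and position `i + (d' - d)` under shift `d` both face letter `i +
  -- d'` of `v`; the margins keep all positions in range.
  have h1 := h'.getElem?_eq (i := i) (j := (i + d').toNat) (by omega) (by omega) (by omega)
  have h2 := h.getElem?_eq (i := i + (d' - d).toNat) (j := (i + d').toNat)
    (by omega) (by omega) (by omega)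
  rw [h1, h2]

end Compatible

/-! ### Growth of the iterates of a primitive morphism. -/

section Growth

theorem IsPrimitive.one_le_length {g : Monoid.End (FreeMonoid X)} (hg : IsPrimitive g) (y : X) :
    1 ≤ (g (FreeMonoid.of y)).length := by
  obtain ⟨k, hk, h⟩ := hg
  by_contra! hlt
  have h1 : g (FreeMonoid.of y) = 1 := FreeMonoid.length_eq_zero.1 (by omega)
  obtain ⟨j, rfl⟩ := Nat.exists_eq_succ_of_ne_zero hk.ne'
  have := h y y
  rw [Nat.succ_eq_add_one, pow_succ_apply, h1, map_one] at this
  exact FreeMonoid.notMem_one this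

theorem IsPrimitive.length_le {g : Monoid.End (FreeMonoid X)} (hg : IsPrimitive g)
    (w : FreeMonoid X) : w.length ≤ (g w).length := by
  simpa using mul_length_le_length_map g 1 hg.one_le_length w

theorem IsPrimitive.length_le_pow {g : Monoid.End (FreeMonoid X)} (hg : IsPrimitive g)
    (w : FreeMonoid X) (k : ℕ) : w.length ≤ ((g ^ k) w).length := by
  induction k with
  | zero => exact le_rfl
  | succ k ih => rw [pow_succ_apply']; exact ih.trans (hg.length_le _)

theorem IsPrimitive.length_pow_mono {g : Monoid.End (FreeMonoid X)} (hg : IsPrimitive g)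
    (w : FreeMonoid X) {i j : ℕ} (h : i ≤ j) : ((g ^ i) w).length ≤ ((g ^ j) w).length := by
  obtain ⟨d, rfl⟩ := Nat.exists_eq_add_of_le' h
  rw [pow_add_apply]
  exact hg.length_le_pow _ _

variable [Fintype X]

theorem length_le_maxLength (g : Monoid.End (FreeMonoid X)) (y : X) :
    (g (FreeMonoid.of y)).length ≤ maxLength g :=
  Finset.le_sup (f := fun x : X => (g (FreeMonoid.of x)).length) (Finset.mem_univ y)

theorem length_pow_le_maxLength_pow (g : Monoid.End (FreeMonoid X)) (y : X) (k : ℕ) :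
    ((g ^ k) (FreeMonoid.of y)).length ≤ maxLength g ^ k := by
  induction k with
  | zero => simp
  | succ k ih =>
    rw [pow_succ_apply', pow_succ']
    exact (length_map_le g _ (length_le_maxLength g) _).trans (Nat.mul_le_mul_left _ ih)

theorem OmegaExists.two_le_maxLength {g : Monoid.End (FreeMonoid X)} {x : X}
    (h : OmegaExists g (FreeMonoid.of x)) : 2 ≤ maxLength g := by
  by_contra! hlt
  obtain ⟨k, hk⟩ := (h.2.eventually_gt_atTop 1).exists
  have h1 := length_pow_le_maxLength_pow g x k
  have h2 : maxLength g ^ k ≤ 1 ^ k := Nat.pow_le_pow_left (by omega) k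
  rw [one_pow] at h2
  omega

/-- The sets of letters reachable in at most `m` steps increase and remain constant after their
first repetition. -/
theorem IsPrimitive.exists_mem_pow {g : Monoid.End (FreeMonoid X)} (hg : IsPrimitive g)
    (y z : X) : ∃ j ≤ Fintype.card X - 1, z ∈ (g ^ j) (FreeMonoid.of y) := by
  classical
  let R : ℕ → Finset X := fun m =>
    Finset.univ.filter fun z => ∃ j ≤ m, z ∈ (g ^ j) (FreeMonoid.of y)
  have hR : ∀ m z, z ∈ R m ↔ ∃ j ≤ m, z ∈ (g ^ j) (FreeMonoid.of y) :=
    fun m z => by simp only [R, Finset.mem_filter, Finset.mem_univ, true_and]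
  have hmono : Monotone R := by
    intro a b hab z hz
    rw [hR] at hz ⊢
    obtain ⟨j, hj, hz⟩ := hz
    exact ⟨j, hj.trans hab, hz⟩
  have hpos : ∀ m, 1 ≤ (R m).card := fun m =>
    Finset.card_pos.2 ⟨y, (hR m y).2 ⟨0, Nat.zero_le _, FreeMonoid.mem_of.2 rfl⟩⟩
  have hstab : ∀ m, R m = R (m + 1) → R (m + 1) = R (m + 2) := by
    intro m hm
    refine Finset.Subset.antisymm (hmono (by omega)) fun z hz => ?_
    rw [hR] at hz
    obtain ⟨j, hj, hz⟩ := hz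
    rcases Nat.lt_or_ge j (m + 2) with hlt | hge
    · exact (hR _ _).2 ⟨j, by omega, hz⟩
    · obtain rfl : j = m + 1 + 1 := by omega
      rw [pow_succ_apply', mem_map_iff] at hz
      obtain ⟨t, ht, hz⟩ := hz
      have : t ∈ R m := by rw [hm, hR]; exact ⟨m + 1, le_rfl, ht⟩
      rw [hR] at this
      obtain ⟨i, hi, hti⟩ := this
      refine (hR _ _).2 ⟨i + 1, by omega, ?_⟩
      rw [pow_succ_apply', mem_map_iff]
      exact ⟨t, hti, hz⟩
  obtain ⟨k, hk, h⟩ := hg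
  set N := max k (Fintype.card X - 1)
  -- The sets already contain `y`, so subtracting 1 from the cardinality saves one step.
  have hN := Nat.stabilises_of_monotone (f := fun m => (R m).card - 1)
    (b := Fintype.card X - 1) (n := N)
    (fun a b hab => Nat.sub_le_sub_right (Finset.card_le_card (hmono hab)) 1)
    (fun m => Nat.sub_le_sub_right (Finset.card_le_univ _) 1)
    (fun m hm => by
      have h1 := hpos m
      have h2 := hpos (m + 1)
      have : R m = R (m + 1) :=
        Finset.eq_of_subset_of_card_le (hmono (Nat.le_succ m)) (by omega)
      simp only [hstab m this])
    (le_max_right _ _)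
  have h1 := hpos N
  have h2 := hpos (Fintype.card X - 1)
  have heq : R (Fintype.card X - 1) = R N :=
    Finset.eq_of_subset_of_card_le (hmono (le_max_right _ _)) (by omega)
  have hz : z ∈ R N := (hR _ _).2 ⟨k, le_max_left _ _, h y z⟩
  rw [← heq, hR] at hz
  exact hz

/-- A letter with the longest image is reached in at most `n - 1` steps; one more application
produces that image. -/
theorem IsPrimitive.maxLength_le_length_pow_card {g : Monoid.End (FreeMonoid X)}
    (hg : IsPrimitive g) (y : X) :
    maxLength g ≤ ((g ^ Fintype.card X) (FreeMonoid.of y)).length := by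
  have hne : (Finset.univ : Finset X).Nonempty := ⟨y, Finset.mem_univ y⟩
  obtain ⟨t, -, ht⟩ := Finset.exists_mem_eq_sup Finset.univ hne
    fun x : X => (g (FreeMonoid.of x)).length
  have hM : maxLength g = (g (FreeMonoid.of t)).length := ht
  obtain ⟨j, hj, hmem⟩ := hg.exists_mem_pow y t
  have hcard : 0 < Fintype.card X := Fintype.card_pos_iff.2 ⟨y⟩
  rw [hM]
  refine le_trans ?_ (hg.length_pow_mono (FreeMonoid.of y) (show j + 1 ≤ Fintype.card X by omega))
  rw [pow_succ_apply']
  exact ((isFactor_of_iff_mem.2 hmem).map g).length_le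

theorem IsPrimitive.maxLength_pow_le_length {g : Monoid.End (FreeMonoid X)}
    (hg : IsPrimitive g) (e : ℕ) (w : FreeMonoid X) :
    maxLength g ^ e * w.length ≤ ((g ^ (Fintype.card X * e)) w).length := by
  induction e with
  | zero => simp
  | succ e ih =>
    rw [show Fintype.card X * (e + 1) = Fintype.card X + Fintype.card X * e by ring,
      pow_add_apply, pow_succ', mul_assoc]
    exact (Nat.mul_le_mul_left _ ih).trans
      (mul_length_le_length_map _ _ hg.maxLength_le_length_pow_card _)

theorem IsPrimitive.isFactor_pow {g : Monoid.End (FreeMonoid X)}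
    (hg : IsPrimitive g) {x : X} (hx : OmegaExists g (FreeMonoid.of x)) (y : X) (m : ℕ) :
    IsFactor ((g ^ m) (FreeMonoid.of x)) ((g ^ (m + (Fintype.card X - 1))) (FreeMonoid.of y)) := by
  obtain ⟨j, hj, hmem⟩ := hg.exists_mem_pow y x
  have h1 := (isFactor_of_iff_mem.2 hmem).map (g ^ (m + (Fintype.card X - 1) - j))
  rw [← pow_add_apply, Nat.sub_add_cancel (by omega)] at h1
  exact (isPrefix_pow hx.1 (by omega)).isFactor.trans h1

end Growth

/-! ### The balance as an orbit of the transposed incidence matrix. -/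

section Balance

/-- The additive extension to words of a weight on letters. -/
def weight (v : X → ℂ) (w : FreeMonoid X) : ℂ := (w.toList.map v).sum

theorem weight_of (v : X → ℂ) (y : X) : weight v (FreeMonoid.of y) = v y := by
  simp [weight]

theorem weight_mul (v : X → ℂ) (u w : FreeMonoid X) :
    weight v (u * w) = weight v u + weight v w := by
  simp [weight]

theorem weight_one (v : X → ℂ) : weight v 1 = 0 := by
  simp [weight]

theorem weight_add (u v : X → ℂ) (w : FreeMonoid X) :
    weight (u + v) w = weight u w + weight v w := by
  induction w using FreeMonoid.inductionOn' with
  | one => simp [weight_one]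
  | of_mul b a ih => simp only [weight_mul, weight_of, ih, Pi.add_apply]; ring

theorem weight_smul (c : ℂ) (v : X → ℂ) (w : FreeMonoid X) :
    weight (c • v) w = c * weight v w := by
  induction w using FreeMonoid.inductionOn' with
  | one => simp [weight_one]
  | of_mul b a ih => simp only [weight_mul, weight_of, ih, Pi.smul_apply, smul_eq_mul]; ring

/-- The action of a morphism on letter weights, by the transpose of its incidence matrix. -/
def weightMap (g : Monoid.End (FreeMonoid X)) : Module.End ℂ (X → ℂ) where
  toFun v y := weight v (g (FreeMonoid.of y))
  map_add' u v := funext fun _ => weight_add u v _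
  map_smul' c v := funext fun _ => weight_smul c v _

theorem weight_weightMap (g : Monoid.End (FreeMonoid X)) (v : X → ℂ) (w : FreeMonoid X) :
    weight (weightMap g v) w = weight v (g w) := by
  induction w using FreeMonoid.inductionOn' with
  | one => simp [weight_one]
  | of_mul b a ih => rw [weight_mul, ih, map_mul, weight_mul, weight_of]; rfl

theorem weightMap_pow_apply (g : Monoid.End (FreeMonoid X)) (v : X → ℂ) (k : ℕ) (y : X) :
    (weightMap g ^ k) v y = weight v ((g ^ k) (FreeMonoid.of y)) := by
  induction k generalizing v with
  | zero => simp [weight_of]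
  | succ k ih =>
    rw [pow_succ, Module.End.mul_apply, ih, weight_weightMap, pow_succ_apply']

/-- The difference `|g(w)| - |h(w)|`. -/
def diff (g h : Monoid.End (FreeMonoid X)) (w : FreeMonoid X) : ℤ :=
  ((g w).length : ℤ) - (h w).length

theorem diff_mul (g h : Monoid.End (FreeMonoid X)) (u w : FreeMonoid X) :
    diff g h (u * w) = diff g h u + diff g h w := by
  simp only [diff, map_mul, FreeMonoid.length_mul]; push_cast; ring

theorem weight_diff (g h : Monoid.End (FreeMonoid X)) (w : FreeMonoid X) :
    weight (fun y => (diff g h (FreeMonoid.of y) : ℂ)) w = diff g h w := by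
  induction w using FreeMonoid.inductionOn' with
  | one => simp [weight_one, diff]
  | of_mul b a ih => rw [weight_mul, ih, diff_mul, weight_of]; push_cast; ring

theorem exists_abs_diff_le {g h : Monoid.End (FreeMonoid X)} (hbal : balance g h < ⊤) :
    ∃ C : ℕ, ∀ (k : ℕ) (y : X), |diff g h ((g ^ k) (FreeMonoid.of y))| ≤ C := by
  obtain ⟨C, hC⟩ := ENat.ne_top_iff_exists.1 hbal.ne
  refine ⟨C, fun k y => ?_⟩
  have h1 : ((diff g h ((g ^ k) (FreeMonoid.of y))).natAbs : ℕ∞) ≤ balance g h :=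
    le_iSup₂ (f := fun (x : X) (k : ℕ) => ((((g ((g ^ k) (FreeMonoid.of x))).length : ℤ) -
      ((h ((g ^ k) (FreeMonoid.of x))).length : ℤ)).natAbs : ℕ∞)) y k
  rw [← hC, Nat.cast_le] at h1
  rw [Int.abs_eq_natAbs]
  exact_mod_cast h1

variable [Fintype X]

theorem norm_weight_le (v : X → ℂ) (w : FreeMonoid X) : ‖weight v w‖ ≤ w.length * ‖v‖ := by
  induction w using FreeMonoid.inductionOn' with
  | one => simp [weight_one]
  | of_mul b a ih =>
    rw [weight_mul, weight_of, FreeMonoid.length_mul, FreeMonoid.length_of]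
    have := norm_le_pi_norm v b
    have := norm_add_le (v b) (weight v a)
    push_cast
    linarith

theorem norm_weightMap_le (g : Monoid.End (FreeMonoid X)) (v : X → ℂ) :
    ‖weightMap g v‖ ≤ maxLength g * ‖v‖ := by
  refine (pi_norm_le_iff_of_nonneg (by positivity)).2 fun y => ?_
  refine (norm_weight_le v _).trans ?_
  gcongr
  exact length_le_maxLength g y

theorem sum_choose_mul_pow_le {n k M : ℕ} (hn : 1 ≤ n) (hk : 2 ≤ k) (hM : 2 ≤ M) :
    ∑ j ∈ Finset.range n, k.choose j * (M + 1) ^ j ≤ M ^ (2 * (n - 1)) * k ^ n := by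
  calc ∑ j ∈ Finset.range n, k.choose j * (M + 1) ^ j
      ≤ ∑ j ∈ Finset.range n, k ^ j * M ^ (2 * (n - 1)) := by
        refine Finset.sum_le_sum fun j hj => Nat.mul_le_mul (Nat.choose_le_pow k j) ?_
        rw [Finset.mem_range] at hj
        calc (M + 1) ^ j ≤ (M ^ 2) ^ j := Nat.pow_le_pow_left (by nlinarith) j
          _ = M ^ (2 * j) := (pow_mul M 2 j).symm
          _ ≤ M ^ (2 * (n - 1)) := Nat.pow_le_pow_right (by omega) (by omega)
    _ = M ^ (2 * (n - 1)) * ∑ j ∈ Finset.range n, k ^ j := by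
        rw [← Finset.sum_mul, mul_comm]
    _ ≤ M ^ (2 * (n - 1)) * k ^ n :=
        Nat.mul_le_mul_left _ (Nat.geomSum_lt hk fun j hj => Finset.mem_range.1 hj).le

/-- If the balance of `g` and `h` is finite, it grows slowly. -/
theorem abs_diff_pow_le {g h : Monoid.End (FreeMonoid X)} (hbal : balance g h < ⊤)
    (hM : 2 ≤ maxLength g) (hgh : maxLength h ≤ maxLength g ^ 2) {k : ℕ} (hk : 2 ≤ k) (y : X) :
    |diff g h ((g ^ k) (FreeMonoid.of y))| ≤
      (maxLength g ^ (2 * Fintype.card X) * k ^ Fintype.card X : ℕ) := by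
  set M := maxLength g with hMdef
  set v : X → ℂ := fun y => (diff g h (FreeMonoid.of y) : ℂ) with hv
  have hval : ∀ (k : ℕ) (y : X),
      ‖(weightMap g ^ k) v y‖ = (|diff g h ((g ^ k) (FreeMonoid.of y))| : ℤ) := by
    intro k y
    rw [weightMap_pow_apply, weight_diff, Complex.norm_intCast, Int.cast_abs]
  -- This is where `M_h ≤ M_g^2` enters.
  have hv2 : ‖v‖ ≤ (M : ℝ) ^ 2 := by
    refine (pi_norm_le_iff_of_nonneg (by positivity)).2 fun y => ?_
    have h1 := length_le_maxLength g y
    have h2 := length_le_maxLength h y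
    have h3 : |diff g h (FreeMonoid.of y)| ≤ (M ^ 2 : ℕ) := by
      have : M ≤ M ^ 2 := by nlinarith
      rw [abs_le]
      constructor <;> simp only [diff] <;> omega
    rw [hv, Complex.norm_intCast]
    exact_mod_cast h3
  have hbd : ∃ C : ℝ, ∀ k : ℕ, ‖(weightMap g ^ k) v‖ ≤ C := by
    obtain ⟨C, hC⟩ := exists_abs_diff_le hbal
    refine ⟨C, fun k => (pi_norm_le_iff_of_nonneg (by positivity)).2 fun y => ?_⟩
    rw [hval]
    exact_mod_cast hC k y
  have key := norm_pow_apply_le_of_bounded (weightMap g) M (by positivity)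
    (norm_weightMap_le g) v hbd k
  rw [Module.finrank_fintype_fun_eq_card] at key
  have hn : 1 ≤ Fintype.card X := Fintype.card_pos_iff.2 ⟨y⟩
  have hsum := sum_choose_mul_pow_le hn hk hM
  have hsum' : (∑ j ∈ Finset.range (Fintype.card X), (k.choose j : ℝ) * ((M : ℝ) + 1) ^ j) ≤
      (M : ℝ) ^ (2 * (Fintype.card X - 1)) * (k : ℝ) ^ Fintype.card X := by
    exact_mod_cast hsum
  have hfin : ((|diff g h ((g ^ k) (FreeMonoid.of y))| : ℤ) : ℝ) ≤
      (M : ℝ) ^ (2 * Fintype.card X) * (k : ℝ) ^ Fintype.card X := by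
    rw [← hval]
    calc _ ≤ ‖(weightMap g ^ k) v‖ := norm_le_pi_norm _ y
      _ ≤ _ := key
      _ ≤ (M : ℝ) ^ (2 * (Fintype.card X - 1)) * (k : ℝ) ^ Fintype.card X * (M : ℝ) ^ 2 := by
        gcongr
      _ = _ := by
        obtain ⟨c, hc⟩ := Nat.exists_eq_add_of_le' hn
        rw [hc, Nat.add_sub_cancel]
        ring
  exact_mod_cast hfin

end Balance

/-! ### Prefixes of infinite words. -/

section InfiniteWords

/-- The prefix of length `N` of the infinite word `s`. -/
def takePrefix (s : ℕ → X) (N : ℕ) : FreeMonoid X := FreeMonoid.ofList ((List.range N).map s)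

/-- The factor of length two of `s` at position `i`. -/
def pair (s : ℕ → X) (i : ℕ) : FreeMonoid X := FreeMonoid.of (s i) * FreeMonoid.of (s (i + 1))

theorem length_takePrefix (s : ℕ → X) (N : ℕ) : (takePrefix s N).length = N := by
  simp [takePrefix, length_eq_toList_length]

theorem takePrefix_zero (s : ℕ → X) : takePrefix s 0 = 1 := rfl

theorem takePrefix_succ (s : ℕ → X) (N : ℕ) :
    takePrefix s (N + 1) = takePrefix s N * FreeMonoid.of (s N) := by
  simp [takePrefix, List.range_succ]

theorem takePrefix_add_two (s : ℕ → X) (N : ℕ) :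
    takePrefix s (N + 2) = takePrefix s N * pair s N := by
  rw [takePrefix_succ, takePrefix_succ, mul_assoc]; rfl

theorem isPrefix_takePrefix (s : ℕ → X) {M N : ℕ} (h : M ≤ N) :
    IsPrefix (takePrefix s M) (takePrefix s N) := by
  induction N, h using Nat.le_induction with
  | base => exact ⟨1, (mul_one _).symm⟩
  | succ N _ ih => exact ih.trans ⟨_, takePrefix_succ s N⟩

theorem getElem?_takePrefix (s : ℕ → X) {i N : ℕ} (h : i < N) :
    (takePrefix s N).toList[i]? = some (s i) := by
  simp [takePrefix, h]

theorem isPrefixInf_iff {u : FreeMonoid X} {s : ℕ → X} :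
    IsPrefixInf u s ↔ u = takePrefix s u.length := by
  constructor
  · intro h
    apply FreeMonoid.toList.injective
    refine List.ext_getElem (length_takePrefix s _).symm fun i h1 h2 => ?_
    rw [← h i h1]
    simp [takePrefix]
  · intro h i hi
    have h1 := getElem?_takePrefix s (i := i) (N := u.length) hi
    rw [← h, List.getElem?_eq_getElem hi] at h1
    exact (Option.some.inj h1).symm

theorem isPrefixInf_takePrefix (s : ℕ → X) (N : ℕ) : IsPrefixInf (takePrefix s N) s := by
  rw [isPrefixInf_iff, length_takePrefix]

theorem IsPrefixInf.of_isPrefix {u v : FreeMonoid X} {s : ℕ → X} (hv : IsPrefixInf v s)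
    (h : IsPrefix u v) : IsPrefixInf u s := by
  intro i hi
  have := h.length_le
  rw [hv i (lt_of_lt_of_le hi this)]
  exact (h.getElem_eq hi _).symm

theorem IsPrefixInf.isPrefix {u v : FreeMonoid X} {s : ℕ → X} (hu : IsPrefixInf u s)
    (hv : IsPrefixInf v s) (h : u.length ≤ v.length) : IsPrefix u v := by
  rw [isPrefixInf_iff.1 hu, isPrefixInf_iff.1 hv]
  exact isPrefix_takePrefix s h

theorem IsPrefixInf.compatible {u v : FreeMonoid X} {s : ℕ → X} (hu : IsPrefixInf u s)
    (hv : IsPrefixInf v s) : Compatible u v := by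
  rcases le_total u.length v.length with h | h
  · exact compatible_of_isPrefix (hu.isPrefix hv h) ⟨1, (mul_one _).symm⟩
  · exact compatible_of_isPrefix ⟨1, (mul_one _).symm⟩ (hv.isPrefix hu h)

theorem omega_eq_of_isPrefixInf {g : Monoid.End (FreeMonoid X)} {w : FreeMonoid X}
    (h : OmegaExists g w) {s : ℕ → X} (hs : ∀ n, IsPrefixInf ((g ^ n) w) s) : omega g w h = s :=
  h.existsUnique.unique (isPrefixInf_omega h) hs

theorem exists_le_lt_succ (L : ℕ → ℕ) (h0 : L 0 = 0) (hL : ∀ N, N ≤ L N) (i : ℕ) :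
    ∃ a, L a ≤ i ∧ i < L (a + 1) := by
  classical
  have hex : ∃ b, i < L b := ⟨i + 1, hL (i + 1)⟩
  have h1 := Nat.find_spec hex
  rcases hb : Nat.find hex with _ | a
  · rw [hb, h0] at h1; omega
  · rw [hb] at h1
    exact ⟨a, not_lt.1 (Nat.find_min hex (by omega)), h1⟩

end InfiniteWords

/-! ### Blocks, pairs and periodicity in the fixed point. -/

section FixedPoint

variable {g : Monoid.End (FreeMonoid X)} {x : X}

theorem exists_isPrefix_pow (hx : OmegaExists g (FreeMonoid.of x)) (N : ℕ) :
    ∃ j, ∀ i, j ≤ i →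
      IsPrefix (takePrefix (omega g (FreeMonoid.of x) hx) N) ((g ^ i) (FreeMonoid.of x)) := by
  obtain ⟨j, hj⟩ := Filter.eventually_atTop.1 (hx.2.eventually_ge_atTop N)
  refine ⟨j, fun i hi => (isPrefixInf_takePrefix _ N).isPrefix (isPrefixInf_omega hx i) ?_⟩
  rw [length_takePrefix]
  exact hj i hi

theorem isPrefixInf_pow_takePrefix (hx : OmegaExists g (FreeMonoid.of x)) (k N : ℕ) :
    IsPrefixInf ((g ^ k) (takePrefix (omega g (FreeMonoid.of x) hx) N))
      (omega g (FreeMonoid.of x) hx) := by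
  obtain ⟨j, hj⟩ := exists_isPrefix_pow hx N
  have h1 := (hj j le_rfl).map (g ^ k)
  rw [← pow_add_apply] at h1
  exact (isPrefixInf_omega hx _).of_isPrefix h1

theorem pow_eq_takePrefix (hx : OmegaExists g (FreeMonoid.of x)) (j : ℕ) :
    (g ^ j) (FreeMonoid.of x) =
      takePrefix (omega g (FreeMonoid.of x) hx) ((g ^ j) (FreeMonoid.of x)).length :=
  isPrefixInf_iff.1 (isPrefixInf_omega hx j)

/-- The letters of the fixed point inside the image of the pair at position `a`. -/
theorem getElem?_pow_pair (hx : OmegaExists g (FreeMonoid.of x)) (k a t : ℕ)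
    (ht : t < ((g ^ k) (pair (omega g (FreeMonoid.of x) hx) a)).length) :
    ((g ^ k) (pair (omega g (FreeMonoid.of x) hx) a)).toList[t]? =
      some (omega g (FreeMonoid.of x) hx
        (((g ^ k) (takePrefix (omega g (FreeMonoid.of x) hx) a)).length + t)) := by
  have h1 := isPrefixInf_iff.1 (isPrefixInf_pow_takePrefix hx k (a + 2))
  rw [takePrefix_add_two, map_mul] at h1
  rw [← getElem?_mul_right ((g ^ k) (takePrefix (omega g (FreeMonoid.of x) hx) a)), h1]
  refine getElem?_takePrefix _ ?_
  rw [FreeMonoid.length_mul]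
  omega

theorem exists_block (hx : OmegaExists g (FreeMonoid.of x)) (hg : IsPrimitive g) (k i : ℕ) :
    ∃ a t, i = ((g ^ k) (takePrefix (omega g (FreeMonoid.of x) hx) a)).length + t ∧
      t < ((g ^ k) (FreeMonoid.of (omega g (FreeMonoid.of x) hx a))).length := by
  obtain ⟨a, h1, h2⟩ := exists_le_lt_succ
    (fun N => ((g ^ k) (takePrefix (omega g (FreeMonoid.of x) hx) N)).length)
    (by simp [takePrefix_zero])
    (fun N => by simpa [length_takePrefix] using
      hg.length_le_pow (takePrefix (omega g (FreeMonoid.of x) hx) N) k) i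
  refine ⟨a, i - ((g ^ k) (takePrefix (omega g (FreeMonoid.of x) hx) a)).length, ?_, ?_⟩
  · omega
  · rw [takePrefix_succ, map_mul, FreeMonoid.length_mul] at h2
    omega

theorem length_pow_pair (s : ℕ → X) (k a : ℕ) :
    ((g ^ k) (pair s a)).length =
      ((g ^ k) (FreeMonoid.of (s a))).length + ((g ^ k) (FreeMonoid.of (s (a + 1)))).length := by
  rw [pair, map_mul, FreeMonoid.length_mul]

theorem IsPrimitive.length_pow_pos (hg : IsPrimitive g) (k : ℕ) (y : X) :
    1 ≤ ((g ^ k) (FreeMonoid.of y)).length := by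
  simpa using hg.length_le_pow (FreeMonoid.of y) k

theorem length_pow_lt_succ (hx : OmegaExists g (FreeMonoid.of x)) (hg : IsPrimitive g) (j : ℕ) :
    ((g ^ j) (FreeMonoid.of x)).length < ((g ^ (j + 1)) (FreeMonoid.of x)).length := by
  obtain ⟨u, hu⟩ := hx.1
  have hu1 : u ≠ 1 := by
    rintro rfl
    rw [mul_one] at hu
    obtain ⟨k, hk⟩ := (hx.2.eventually_gt_atTop 1).exists
    have : ∀ k, (g ^ k) (FreeMonoid.of x) = FreeMonoid.of x := by
      intro k
      induction k with
      | zero => rfl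
      | succ k ih => rw [pow_succ_apply, hu, ih]
    rw [this, FreeMonoid.length_of] at hk
    omega
  rw [pow_succ_apply, hu, map_mul, FreeMonoid.length_mul]
  have := hg.length_le_pow u j
  have := length_pos_iff_ne_one.2 hu1
  omega

/-- All factors of length two of the fixed point occur early. -/
theorem exists_pair_eq [Fintype X] (hx : OmegaExists g (FreeMonoid.of x)) (hg : IsPrimitive g)
    (i : ℕ) : ∃ i₀, i₀ + 1 < ((g ^ (Fintype.card X ^ 2 + 1)) (FreeMonoid.of x)).length ∧
      omega g (FreeMonoid.of x) hx i₀ = omega g (FreeMonoid.of x) hx i ∧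
      omega g (FreeMonoid.of x) hx (i₀ + 1) = omega g (FreeMonoid.of x) hx (i + 1) := by
  classical
  set s := omega g (FreeMonoid.of x) hx with hs
  set L : ℕ → ℕ := fun j => ((g ^ j) (FreeMonoid.of x)).length with hL
  let F : ℕ → Finset (X × X) := fun j => (Finset.range (L j)).image fun i => (s i, s (i + 1))
  have hF : ∀ j p, p ∈ F j ↔ ∃ i, i < L j ∧ s i = p.1 ∧ s (i + 1) = p.2 := by
    intro j p
    simp only [F, Finset.mem_image, Finset.mem_range, Prod.ext_iff]
  have hmono : Monotone F := by
    intro a b hab p hp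
    rw [hF] at hp ⊢
    obtain ⟨i, hi, hp⟩ := hp
    exact ⟨i, hi.trans_le (hg.length_pow_mono _ hab), hp⟩
  have hgL : ∀ j, (g ((takePrefix s (L j)))).length = L (j + 1) := by
    intro j
    rw [hL, hs, ← pow_eq_takePrefix hx j, ← pow_succ_apply']
  -- The pair at `i` lies inside the `g`-image of a pair at some `a`; an earlier copy of the latter
  -- yields an earlier copy of the former.
  have hstab : ∀ j, F j = F (j + 1) → F (j + 1) = F (j + 2) := by
    intro j hj
    refine Finset.Subset.antisymm (hmono (by omega)) fun p hp => ?_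
    rw [hF] at hp
    obtain ⟨i, hi, hp1, hp2⟩ := hp
    obtain ⟨a, t, hi', ht⟩ := exists_block hx hg 1 i
    rw [← hs, pow_one] at hi' ht
    have ha : a < L (j + 1) := by
      by_contra! hle
      have := ((isPrefix_takePrefix s hle).map g).length_le
      rw [hgL] at this
      change i < L (j + 1 + 1) at hi
      omega
    have hmem : (s a, s (a + 1)) ∈ F j := by
      rw [hj, hF]
      exact ⟨a, ha, rfl, rfl⟩
    rw [hF] at hmem
    obtain ⟨a₀, ha₀, hs1, hs2⟩ := hmem
    dsimp only at hs1 hs2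
    have hpair : pair s a₀ = pair s a := by rw [pair, pair, hs1, hs2]
    have hpos := hg.length_pow_pos 1 (s (a + 1))
    have hlen := length_pow_pair (g := g) s 1 a
    rw [pow_one] at hpos hlen
    have hget : ∀ t, t < (g (pair s a)).length →
        s ((g (takePrefix s a₀)).length + t) = s ((g (takePrefix s a)).length + t) := by
      intro t ht
      have h1 := getElem?_pow_pair hx 1 a t (by rw [pow_one]; exact ht)
      have h2 := getElem?_pow_pair hx 1 a₀ t (by rw [pow_one, ← hs, hpair]; exact ht)
      rw [← hs, pow_one] at h1 h2
      rw [hpair, h1] at h2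
      exact (Option.some.inj h2).symm
    rw [hF]
    refine ⟨(g (takePrefix s a₀)).length + t, ?_, ?_, ?_⟩
    · have := ((isPrefix_takePrefix s (show a₀ + 1 ≤ L j from ha₀)).map g).length_le
      rw [hgL, takePrefix_succ, map_mul, FreeMonoid.length_mul, hs1] at this
      omega
    · rw [hget t (by omega), ← hi', hp1]
    · rw [add_assoc, hget (t + 1) (by omega), ← add_assoc, ← hi', hp2]
  obtain ⟨N, hN⟩ : ∃ N, i < L N := (hx.2.eventually_gt_atTop i).exists
  set N' := max N (Fintype.card X ^ 2)
  have hcard := Nat.stabilises_of_monotone (f := fun j => (F j).card)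
    (b := Fintype.card X ^ 2) (n := N')
    (fun a b hab => Finset.card_le_card (hmono hab))
    (fun m => (Finset.card_le_univ _).trans (by rw [Fintype.card_prod, sq]))
    (fun m hm => by
      have : F m = F (m + 1) :=
        Finset.eq_of_subset_of_card_le (hmono (Nat.le_succ m)) (by omega)
      simp only [hstab m this])
    (le_max_right _ _)
  have heq : F (Fintype.card X ^ 2) = F N' :=
    Finset.eq_of_subset_of_card_le (hmono (le_max_right _ _)) (by omega)
  have hmem : (s i, s (i + 1)) ∈ F N' :=
    (hF _ _).2 ⟨i, hN.trans_le (hg.length_pow_mono _ (le_max_left _ _)), rfl, rfl⟩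
  rw [← heq, hF] at hmem
  obtain ⟨i₀, h1, h2, h3⟩ := hmem
  -- One extra iterate makes room for the second letter of the pair.
  have : L (Fintype.card X ^ 2) < _ := length_pow_lt_succ hx hg (Fintype.card X ^ 2)
  exact ⟨i₀, by omega, h2, h3⟩

theorem isLooping_of_periodic (hx : OmegaExists g (FreeMonoid.of x)) {p : ℕ} (hp : 0 < p)
    (h : Function.Periodic (omega g (FreeMonoid.of x) hx) p) : IsLooping g := by
  have hu : takePrefix (omega g (FreeMonoid.of x) hx) p ≠ 1 := by
    rw [← length_pos_iff_ne_one, length_takePrefix]; exact hp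
  refine ⟨1, x, _, hu, by rwa [pow_one], Nat.one_pos, ?_⟩
  rw [omega_eq_of_isPrefixInf (s := omega g (FreeMonoid.of x) hx) _ fun n => by
    rw [pow_one]; exact isPrefixInf_omega hx n]
  funext i
  have hlen : (takePrefix (omega g (FreeMonoid.of x) hx) p).toList.length = p :=
    length_takePrefix _ p
  have hlt : i % (takePrefix (omega g (FreeMonoid.of x) hx) p).toList.length < p := by
    rw [hlen]; exact Nat.mod_lt i hp
  have h1 := isPrefixInf_takePrefix (omega g (FreeMonoid.of x) hx) p
    (i % (takePrefix (omega g (FreeMonoid.of x) hx) p).toList.length) (by omega)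
  refine Eq.trans ?_ h1
  rw [hlen]
  exact (h.map_mod_nat i).symm

/-- A fixed point whose pairs all have images with a common small period is periodic. -/
theorem isLooping_of_pairs_periodic (hx : OmegaExists g (FreeMonoid.of x)) (hg : IsPrimitive g)
    {K p : ℕ} (hp : 0 < p) (hle : ∀ y, p ≤ ((g ^ K) (FreeMonoid.of y)).length)
    (hper : ∀ a t, t + p < ((g ^ K) (pair (omega g (FreeMonoid.of x) hx) a)).length →
      ((g ^ K) (pair (omega g (FreeMonoid.of x) hx) a)).toList[t]? =
        ((g ^ K) (pair (omega g (FreeMonoid.of x) hx) a)).toList[t + p]?) : IsLooping g := by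
  refine isLooping_of_periodic hx hp fun i => ?_
  obtain ⟨a, t, hi, ht⟩ := exists_block hx hg K i
  have hlen := length_pow_pair (g := g) (omega g (FreeMonoid.of x) hx) K a
  have := hle (omega g (FreeMonoid.of x) hx (a + 1))
  have h1 := hper a t (by omega)
  rw [getElem?_pow_pair hx K a t (by omega), getElem?_pow_pair hx K a (t + p) (by omega),
    ← add_assoc, ← hi] at h1
  exact (Option.some.inj h1).symm

end FixedPoint

/-! ### Uniqueness of shifts, propagation of compatibility, and the bound. -/

section Main

variable {g h : Monoid.End (FreeMonoid X)} {x : X}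

theorem exists_eq_mul_of_mul {u : FreeMonoid X} (hu : 3 ≤ u.length) :
    ∃ (a b : FreeMonoid X) (t : X), u = a * FreeMonoid.of t * b ∧ 1 ≤ a.length ∧ 1 ≤ b.length := by
  obtain ⟨c, u, rfl⟩ : ∃ c v, u = FreeMonoid.of c * v := by
    cases u using FreeMonoid.casesOn with
    | one => simp at hu
    | of_mul c v => exact ⟨c, v, rfl⟩
  obtain ⟨t, u, rfl⟩ : ∃ c v, u = FreeMonoid.of c * v := by
    cases u using FreeMonoid.casesOn with
    | one => simp at hu
    | of_mul c v => exact ⟨c, v, rfl⟩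
  refine ⟨FreeMonoid.of c, u, t, by rw [mul_assoc], by simp, ?_⟩
  simp only [FreeMonoid.length_mul, FreeMonoid.length_of] at hu
  omega

/-- The image of any letter under a high power of `g` contains the image of any pair of the fixed
point, far away from both ends. -/
theorem exists_pow_eq_mul_pair_mul [Fintype X] (hx : OmegaExists g (FreeMonoid.of x))
    (hg : IsPrimitive g) (e : ℕ) (y : X) (i : ℕ) :
    ∃ P Q, (g ^ (Fintype.card X * e + (Fintype.card X ^ 2 + 1 + (Fintype.card X - 1)) +
        Fintype.card X * 2)) (FreeMonoid.of y) =
        P * (g ^ (Fintype.card X * e)) (pair (omega g (FreeMonoid.of x) hx) i) * Q ∧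
      maxLength g ^ e ≤ P.length ∧ maxLength g ^ e ≤ Q.length := by
  have hM := hx.two_le_maxLength
  have h2 := hg.maxLength_pow_le_length 2 (FreeMonoid.of y)
  rw [FreeMonoid.length_of, mul_one] at h2
  -- `g^(2n)(y)` has length at least `M^2 ≥ 4`, so it has an inner letter `t`; its neighbours supply
  -- the margins.
  obtain ⟨a, b, t, hab, ha, hb⟩ := exists_eq_mul_of_mul
    (u := (g ^ (Fintype.card X * 2)) (FreeMonoid.of y)) (by nlinarith)
  obtain ⟨i₀, hi₀, hs1, hs2⟩ := exists_pair_eq hx hg i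
  have hfac : IsFactor (pair (omega g (FreeMonoid.of x) hx) i)
      ((g ^ (Fintype.card X ^ 2 + 1 + (Fintype.card X - 1))) (FreeMonoid.of t)) := by
    refine IsFactor.trans ?_ (hg.isFactor_pow hx t _)
    rw [pow_eq_takePrefix hx]
    refine IsFactor.trans ?_ (isPrefix_takePrefix _ (show i₀ + 2 ≤ _ by omega)).isFactor
    rw [takePrefix_add_two, pair, pair, hs1, hs2]
    exact ⟨_, 1, (mul_one _).symm⟩
  obtain ⟨c, d, hcd⟩ := hfac
  set r := Fintype.card X ^ 2 + 1 + (Fintype.card X - 1)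
  have hlen : ∀ w : FreeMonoid X, 1 ≤ w.length →
      maxLength g ^ e ≤ ((g ^ (Fintype.card X * e)) ((g ^ r) w)).length := by
    intro w hw
    refine le_trans ?_ (hg.maxLength_pow_le_length e _)
    exact Nat.le_mul_of_pos_right _ (hw.trans (hg.length_le_pow w r))
  refine ⟨(g ^ (Fintype.card X * e)) ((g ^ r) a * c), (g ^ (Fintype.card X * e)) (d * (g ^ r) b),
    ?_, ?_, ?_⟩
  · rw [pow_add_apply, pow_add_apply, hab]
    simp only [map_mul, hcd, mul_assoc]
  · rw [map_mul, FreeMonoid.length_mul]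
    exact (hlen a ha).trans (Nat.le_add_right _ _)
  · rw [map_mul, FreeMonoid.length_mul]
    exact (hlen b hb).trans (Nat.le_add_left _ _)

theorem abs_diff_pow_le_length_mul {k C : ℕ}
    (hC : ∀ y, |diff g h ((g ^ k) (FreeMonoid.of y))| ≤ C) (w : FreeMonoid X) :
    |diff g h ((g ^ k) w)| ≤ (w.length * C : ℕ) := by
  induction w using FreeMonoid.inductionOn' with
  | one => simp [diff]
  | of_mul b a ih =>
    rw [map_mul, diff_mul, FreeMonoid.length_mul, FreeMonoid.length_of]
    refine (abs_add_le _ _).trans ?_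
    have := hC b
    rw [Nat.cast_mul] at ih ⊢
    rw [Nat.cast_add, Nat.cast_one, add_mul, one_mul]
    exact add_le_add this ih

/-- Equality of shifts: in a compatible range, the balance before an occurrence of a letter
depends on the letter only. -/
theorem diff_takePrefix_eq [Fintype X] (hx : OmegaExists g (FreeMonoid.of x))
    (hg : IsPrimitive g) (hfree : IsLoopFree g) {k e B m : ℕ}
    (hk : k + 1 = Fintype.card X * e + (Fintype.card X ^ 2 + 1 + (Fintype.card X - 1)) +
        Fintype.card X * 2)
    (hBe : 2 * B ≤ maxLength g ^ e)
    (hB : ∀ i ≤ m, |diff g h ((g ^ k) (takePrefix (omega g (FreeMonoid.of x) hx) i))| ≤ B)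
    (hB1 : ∀ y, |diff g h ((g ^ k) (FreeMonoid.of y))| ≤ B)
    (hcomp : Compatible (g ((g ^ k) (takePrefix (omega g (FreeMonoid.of x) hx) m)))
      (h ((g ^ k) (takePrefix (omega g (FreeMonoid.of x) hx) m))))
    {i j : ℕ} (hi : i < m) (hj : j < m)
    (hij : omega g (FreeMonoid.of x) hx i = omega g (FreeMonoid.of x) hx j) :
    diff g h ((g ^ k) (takePrefix (omega g (FreeMonoid.of x) hx) i)) =
      diff g h ((g ^ k) (takePrefix (omega g (FreeMonoid.of x) hx) j)) := by
  set s := omega g (FreeMonoid.of x) hx with hs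
  by_contra hne
  wlog hlt : diff g h ((g ^ k) (takePrefix s i)) < diff g h ((g ^ k) (takePrefix s j))
    generalizing i j
  · exact this hj hi hij.symm (Ne.symm hne) (lt_of_le_of_ne (not_lt.1 hlt) (Ne.symm hne))
  have hc : ∀ i < m, Compatible
      (g ((g ^ k) (takePrefix s i)) * g ((g ^ k) (FreeMonoid.of (s i))))
      (h ((g ^ k) (takePrefix s i)) * h ((g ^ k) (FreeMonoid.of (s i)))) := by
    intro i hi
    have hp := (isPrefix_takePrefix s (show i + 1 ≤ m from hi)).map (g ^ k)
    have := hcomp.of_isPrefix (hp.map g) (hp.map h)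
    rwa [takePrefix_succ, map_mul, map_mul, map_mul] at this
  have hci := hc i hi
  have hcj := hc j hj
  rw [← hij] at hcj
  have hBi := hB i hi.le
  have hBj := hB j hj.le
  have hBy := hB1 (s i)
  set p : ℕ :=
    (diff g h ((g ^ k) (takePrefix s j)) - diff g h ((g ^ k) (takePrefix s i))).toNat with hp
  have hper := fun t => Compatible.periodic (d := diff g h ((g ^ k) (takePrefix s i)))
    (d' := diff g h ((g ^ k) (takePrefix s j))) (B := B) hci hcj rfl rfl hBi hBj hlt
    (by rw [abs_le] at hBy; simp only [diff] at hBy; omega) t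
  rw [abs_le] at hBi hBj
  -- The period satisfies `p ≤ 2 * B ≤ M^e`, so it fits in every block, and the margins `P`, `Q`
  -- exceed those demanded by `hper`.
  refine hfree (isLooping_of_pairs_periodic hx hg (K := Fintype.card X * e) (p := p) (by omega)
    (fun y => ?_) fun a t ht => ?_)
  · have := hg.maxLength_pow_le_length e (FreeMonoid.of y)
    rw [FreeMonoid.length_of, mul_one] at this
    omega
  · obtain ⟨P, Q, hPQ, hP, hQ⟩ := exists_pow_eq_mul_pair_mul hx hg e (s i) a
    rw [← hk, pow_succ_apply', ← hs] at hPQ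
    rw [← hs] at ht ⊢
    have hget : ∀ t, t < ((g ^ (Fintype.card X * e)) (pair s a)).length →
        (g ((g ^ k) (FreeMonoid.of (s i)))).toList[P.length + t]? =
          ((g ^ (Fintype.card X * e)) (pair s a)).toList[t]? := by
      intro t ht
      rw [hPQ, mul_assoc, getElem?_mul_right, getElem?_mul_left _ _ ht]
    have h1 := hper (P.length + t) (by omega)
      (by rw [hPQ, FreeMonoid.length_mul, FreeMonoid.length_mul]; omega)
    rwa [← hp, add_assoc, hget t (by omega), hget (t + p) ht] at h1

/-- Compatibility on a prefix that is long enough for all pairs and shifts propagates along the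
whole fixed point. -/
theorem compatible_pow_takePrefix [Fintype X] (hx : OmegaExists g (FreeMonoid.of x))
    (hg : IsPrimitive g) (hh : IsPrimitive h) (hfree : IsLoopFree g) {k e B m : ℕ}
    (hk : k + 1 = Fintype.card X * e + (Fintype.card X ^ 2 + 1 + (Fintype.card X - 1)) +
        Fintype.card X * 2)
    (hm : m = ((g ^ (Fintype.card X ^ 2 + 1)) (FreeMonoid.of x)).length)
    (hBe : 2 * B ≤ maxLength g ^ e)
    (hB : ∀ i ≤ m, |diff g h ((g ^ k) (takePrefix (omega g (FreeMonoid.of x) hx) i))| ≤ B)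
    (hB1 : ∀ y, |diff g h ((g ^ k) (FreeMonoid.of y))| ≤ B)
    (hcomp : Compatible (g ((g ^ k) (takePrefix (omega g (FreeMonoid.of x) hx) m)))
      (h ((g ^ k) (takePrefix (omega g (FreeMonoid.of x) hx) m)))) (N : ℕ) :
    Compatible (g ((g ^ k) (takePrefix (omega g (FreeMonoid.of x) hx) (N + 1))))
      (h ((g ^ k) (takePrefix (omega g (FreeMonoid.of x) hx) (N + 1)))) := by
  set s := omega g (FreeMonoid.of x) hx with hs
  have hsub : ∀ i ≤ m, Compatible (g ((g ^ k) (takePrefix s i))) (h ((g ^ k) (takePrefix s i))) :=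
    fun i hi => hcomp.of_isPrefix (((isPrefix_takePrefix s hi).map _).map _)
      (((isPrefix_takePrefix s hi).map _).map _)
  have hcard : 1 ≤ Fintype.card X := Fintype.card_pos_iff.2 ⟨x⟩
  have hlong : ∀ y, B ≤ ((g ^ k) (FreeMonoid.of y)).length := by
    intro y
    have h1 := hg.maxLength_pow_le_length e (FreeMonoid.of y)
    rw [FreeMonoid.length_of, mul_one] at h1
    have h2 := hg.length_pow_mono (FreeMonoid.of y) (show Fintype.card X * e ≤ k by omega)
    omega
  -- The induction also carries an early position with the same letter and the same shift as `N`.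
  suffices H : Compatible (g ((g ^ k) (takePrefix s (N + 1)))) (h ((g ^ k) (takePrefix s (N + 1)))) ∧
      ∃ i < m, s i = s N ∧
        diff g h ((g ^ k) (takePrefix s i)) = diff g h ((g ^ k) (takePrefix s N)) from H.1
  induction N with
  | zero =>
    have : 1 ≤ m := hm ▸ hg.length_pow_pos _ x
    exact ⟨hsub 1 this, 0, this, rfl, rfl⟩
  | succ N ih =>
    obtain ⟨hN, i, hi, hsi, hdi⟩ := ih
    obtain ⟨i₀, hi₀, hs1, hs2⟩ := exists_pair_eq hx hg N
    rw [← hs] at hs1 hs2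
    rw [← hm] at hi₀
    -- `N` itself may lie outside the known range, so shifts are compared at the early positions
    -- `i₀` and `i`.
    have hd0 := diff_takePrefix_eq hx hg hfree hk hBe hB hB1 hcomp (i := i₀) (j := i) (by omega) hi
      (by rw [← hs, hs1, hsi])
    rw [← hs, hdi] at hd0
    have hd1 : diff g h ((g ^ k) (takePrefix s (i₀ + 1))) =
        diff g h ((g ^ k) (takePrefix s (N + 1))) := by
      rw [takePrefix_succ, takePrefix_succ, map_mul, map_mul, diff_mul, diff_mul, hd0, hs1]
    refine ⟨?_, i₀ + 1, hi₀, hs2, hd1⟩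
    have h0 := hsub (i₀ + 2) hi₀
    have hB0 := hB (i₀ + 1) (by omega)
    rw [hd1, abs_le] at hB0
    rw [show N + 1 + 1 = N + 2 from rfl]
    rw [takePrefix_add_two, pair] at h0 ⊢
    rw [takePrefix_succ] at hN hd1 hB0
    rw [takePrefix_succ] at hd1
    rw [hs1, hs2] at h0
    rw [hs1] at hd1
    have hlg := (hlong (s N)).trans (hg.length_le _)
    have hlh := (hlong (s N)).trans (hh.length_le _)
    simp only [map_mul, ← mul_assoc, diff] at h0 hN hd1 hB0 ⊢
    exact hN.extend h0 (by omega) (by omega) (by omega)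

/-- If `h^j(x)` is a prefix of `g^i(x)`, then `h^(j+1)(x)` is a prefix of `h(g^i(x))`, hence, for
large compatible `i`, of `g^(i+1)(x)`. -/
theorem omega_eq_of_frequently_compatible (hx : OmegaExists g (FreeMonoid.of x))
    (hhx : OmegaExists h (FreeMonoid.of x))
    (hc : ∀ N, ∃ j, N ≤ j ∧
      Compatible (g ((g ^ j) (FreeMonoid.of x))) (h ((g ^ j) (FreeMonoid.of x)))) :
    omega g (FreeMonoid.of x) hx = omega h (FreeMonoid.of x) hhx := by
  refine (omega_eq_of_isPrefixInf hhx fun j => ?_).symm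
  induction j with
  | zero => exact isPrefixInf_omega hx 0
  | succ j ih =>
    obtain ⟨i₀, hi₀⟩ := exists_isPrefix_pow hx ((h ^ j) (FreeMonoid.of x)).length
    obtain ⟨i₁, hi₁⟩ := Filter.eventually_atTop.1
      (hx.2.eventually_ge_atTop ((h ^ (j + 1)) (FreeMonoid.of x)).length)
    obtain ⟨i, hi, hci⟩ := hc (max i₀ i₁)
    have h1 := hi₀ i ((le_max_left _ _).trans hi)
    rw [← isPrefixInf_iff.1 ih] at h1
    have h2 := h1.map h
    rw [← pow_succ_apply'] at h2
    have h3 := hi₁ (i + 1) (((le_max_right _ _).trans hi).trans (Nat.le_succ i))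
    rw [← pow_succ_apply'] at hci
    have h4 := (hci.symm.of_isPrefix h2 ⟨1, (mul_one _).symm⟩).isPrefix h3
    exact (isPrefixInf_omega hx (i + 1)).of_isPrefix h4

/-- Already `√(2 log 2) > 10/9`. -/
theorem ten_mul_pow_three_le_boundA {n : ℕ} (hn : 2 ≤ n) : 10 * n ^ 3 ≤ boundA n := by
  refine Nat.le_floor ?_
  have hn' : (2 : ℝ) ≤ n := by exact_mod_cast hn
  have hlog : Real.log 2 ≤ Real.log n := Real.log_le_log (by norm_num) hn'
  have h2 := Real.log_two_gt_d9
  have h1 : (10 / 9 : ℝ) ≤ Real.sqrt (n * Real.log n) := by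
    refine Real.le_sqrt_of_sq_le ?_
    nlinarith
  have h3 : (0 : ℝ) ≤ (n : ℝ) ^ 3 := by positivity
  push_cast
  nlinarith

theorem le_sixteen_pow {n : ℕ} (hn : 2 ≤ n) : 10 * n ^ 3 ≤ 16 ^ n := by
  induction n, hn using Nat.le_induction with
  | base => norm_num
  | succ n hn ih =>
    rw [pow_succ 16]
    have : 10 * (n + 1) ^ 3 ≤ 16 * (10 * n ^ 3) := by
      have : (n + 1) ^ 3 ≤ (2 * n) ^ 3 := Nat.pow_le_pow_left (by omega) 3
      nlinarith
    omega

/-- If `g` and `h` are compatible on a sufficiently high iterate, the fixed points agree. -/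
theorem omega_eq_of_compatible [Fintype X] (hn : 2 ≤ Fintype.card X)
    (hg : IsPrimitive g) (hh : IsPrimitive h) (hgx : OmegaExists g (FreeMonoid.of x))
    (hhx : OmegaExists h (FreeMonoid.of x)) (hfree : IsLoopFree g) (hbal : balance g h < ⊤)
    (hM : maxLength h ≤ maxLength g ^ 2) {A : ℕ} (hA : 10 * Fintype.card X ^ 3 ≤ A)
    (hc : Compatible (g ((g ^ A) (FreeMonoid.of x))) (h ((g ^ A) (FreeMonoid.of x)))) :
    omega g (FreeMonoid.of x) hgx = omega h (FreeMonoid.of x) hhx := by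
  set n := Fintype.card X with hndef
  set s := omega g (FreeMonoid.of x) hgx with hs
  have hM2 := hgx.two_le_maxLength
  set M := maxLength g with hMdef
  set m := ((g ^ (n ^ 2 + 1)) (FreeMonoid.of x)).length with hm
  -- The exponent collects 1 from the factor 2, `n^2 + 1` from `m`, `2n` from the balance bound and
  -- `4n^2` from `k^n`. Although `k` depends on `e`, `k < 10 n^3 ≤ 16^n` breaks the circle.
  set e := 5 * n ^ 2 + 2 * n + 2 with he
  have hn3 : 2 * n ^ 2 ≤ n ^ 3 := by
    rw [pow_succ' n 2]; exact Nat.mul_le_mul_right _ hn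
  have hn2 : 2 * n ≤ n ^ 2 := by rw [sq]; exact Nat.mul_le_mul_right _ hn
  have hne : n * e = 5 * n ^ 3 + 2 * n ^ 2 + 2 * n := by rw [he]; ring
  obtain ⟨k, hk⟩ : ∃ k, k + 1 = n * e + (n ^ 2 + 1 + (n - 1)) + n * 2 :=
    ⟨n * e + (n ^ 2 + 1 + (n - 1)) + n * 2 - 1, by omega⟩
  have hk2 : 2 ≤ k := by omega
  -- The prefix of length `m` is `g^(n^2+1)(x)`, so its image under `g^k` is a prefix of `g^A(x)`.
  have hkA : k + (n ^ 2 + 1) ≤ 10 * n ^ 3 := by omega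
  set C := M ^ (2 * n) * k ^ n with hCdef
  have hC : ∀ y, |diff g h ((g ^ k) (FreeMonoid.of y))| ≤ C :=
    fun y => abs_diff_pow_le hbal hM2 hM hk2 y
  have hmM : m ≤ M ^ (n ^ 2 + 1) := length_pow_le_maxLength_pow g x _
  have hm1 : 1 ≤ m := hg.length_pow_pos _ x
  have hkn : k ^ n ≤ M ^ (4 * n ^ 2) := by
    calc k ^ n ≤ (16 ^ n) ^ n :=
          Nat.pow_le_pow_left (by have := le_sixteen_pow hn; omega) n
      _ = 2 ^ (4 * n ^ 2) := by
        rw [show (16 : ℕ) = 2 ^ 4 by norm_num, ← pow_mul, ← pow_mul]; congr 1; ring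
      _ ≤ M ^ (4 * n ^ 2) := Nat.pow_le_pow_left hM2 _
  have hBe : 2 * (m * C) ≤ M ^ e := by
    calc 2 * (m * C) ≤ M * (M ^ (n ^ 2 + 1) * (M ^ (2 * n) * M ^ (4 * n ^ 2))) := by
          rw [hCdef]; gcongr
      _ = M ^ e := by rw [he]; ring
  have hw : takePrefix s m = (g ^ (n ^ 2 + 1)) (FreeMonoid.of x) :=
    (pow_eq_takePrefix hgx (n ^ 2 + 1)).symm
  refine omega_eq_of_frequently_compatible hgx hhx fun N => ?_
  refine ⟨k + N, by omega, ?_⟩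
  have hle : 1 ≤ ((g ^ N) (FreeMonoid.of x)).length := hg.length_pow_pos _ x
  have key := compatible_pow_takePrefix hgx hg hh hfree hk hm hBe (h := h)
    (fun i hi => (abs_diff_pow_le_length_mul hC _).trans
      (by rw [length_takePrefix]; exact_mod_cast Nat.mul_le_mul_right C hi))
    (fun y => (hC y).trans (by exact_mod_cast Nat.le_mul_of_pos_left C hm1))
    (by
      have hp : IsPrefix ((g ^ k) (takePrefix s m)) ((g ^ A) (FreeMonoid.of x)) := by
        rw [hw, ← pow_add_apply]
        exact isPrefix_pow hgx.1 (hkA.trans hA)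
      exact hc.of_isPrefix (hp.map g) (hp.map h))
    (((g ^ N) (FreeMonoid.of x)).length - 1)
  rw [Nat.sub_add_cancel hle, ← pow_eq_takePrefix hgx N, ← pow_add_apply] at key
  exact key

theorem compatible_of_omega_eq (hgx : OmegaExists g (FreeMonoid.of x))
    (hhx : OmegaExists h (FreeMonoid.of x))
    (heq : omega g (FreeMonoid.of x) hgx = omega h (FreeMonoid.of x) hhx) (A : ℕ) :
    Compatible (g ((g ^ A) (FreeMonoid.of x))) (h ((g ^ A) (FreeMonoid.of x))) := by
  have h1 : IsPrefixInf (g ((g ^ A) (FreeMonoid.of x))) (omega g (FreeMonoid.of x) hgx) := by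
    rw [← pow_succ_apply']; exact isPrefixInf_omega hgx _
  have h2 := isPrefixInf_pow_takePrefix hhx 1 ((g ^ A) (FreeMonoid.of x)).length
  rw [← heq, ← pow_eq_takePrefix hgx A, pow_one] at h2
  exact h1.compatible h2

end Main

end MorphicWord

theorem lemma13 {X : Type*} [Fintype X] (n : ℕ) (hn : 2 ≤ n) (hX : Fintype.card X = n)
    (g h : Monoid.End (FreeMonoid X))
    (hg : MorphicWord.IsPrimitive g) (hh : MorphicWord.IsPrimitive h) (x : X)
    (hgx : MorphicWord.OmegaExists g (FreeMonoid.of x))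
    (hhx : MorphicWord.OmegaExists h (FreeMonoid.of x))
    (hfree : MorphicWord.IsLoopFree g)
    (hbal : MorphicWord.balance g h < ⊤)
    (hM : MorphicWord.maxLength h ≤ MorphicWord.maxLength g ^ 2) :
    MorphicWord.omega g (FreeMonoid.of x) hgx = MorphicWord.omega h (FreeMonoid.of x) hhx ↔
      (g ^ MorphicWord.boundA n) (FreeMonoid.of x) ∈ MorphicWord.comp g h := by
  subst hX
  exact ⟨fun heq => MorphicWord.compatible_of_omega_eq hgx hhx heq _,
    fun hc => MorphicWord.omega_eq_of_compatible hn hg hh hgx hhx hfree hbal hM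
      (MorphicWord.ten_mul_pow_three_le_boundA hn) hc⟩
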